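/- Let $X$ and $Z$ be real Hausdorff topological vector spaces. Let $C\subseteq Z$ be a convex and pointed cone (that is, $tc\in C$ for all $c\in C$ and $t\ge 0$, $C+C=C$, and $C\cap(-C)=\{0\}$) with nonempty interior $\operatorname{int} C$; $C$ is not assumed closed. Let $K\subseteq X$ be nonempty, convex and closed. Let $f,g:K\times K\to Z$ satisfy: (i) for every $y\in K$, every $x\in K$ and every net $(x_\alpha)\subseteq K$ with $\lim x_\alpha=x$, there exists a net $(z_\alpha)\subseteq Z$ with the same index set, converging to some $z\in Z$, such that $f(x_\alpha,y)+g(x_\alpha,y)-z_\alpha\in -C$ for all $\alpha$, and $f(x,y)+g(x,y)-z\in C$; (ii) for every $x\in K$, the mappings $y\mapsto f(x,y)$ and $y\mapsto g(x,y)$ are $C$-convex on $K$, where $h:K\to Z$ is called $C$-convex if $t\,h(u)+(1-t)\,h(v)-h(tu+(1-t)v)\in C$ for all $u,v\in K$ and $t\in[0,1]$; (iii) for every $x\in K$, $f(x,x)=0$ and $g(x,x)\notin -\operatorname{int} C$; (iv) there exist a nonempty compact set $K_0\subseteq X$ and a point $y_0\in K$ such that $f(x,y_0)+g(x,y_0)\in-\operatorname{int}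 C$ for all $x\in K\setminus K_0$. Then there exists $x_0\in K$ such that $f(x_0,y)+g(x_0,y)\notin-\operatorname{int} C$ for all $y\in K$. -/

import Mathlib

open Set Filter Topology
open scoped Pointwise

universe u v

/-- `h` is `C`-convex on the (convex) set `K`:
`t h(x) + (1 - t) h(y) - h(t x + (1 - t) y) ∈ C` for all `x, y ∈ K` and `t ∈ [0, 1]`.
Only the values of `h` on `K` matter. -/
def CConvexOn {X : Type u} {Z : Type v} [AddCommGroup X] [Module ℝ X] [AddCommGroup Z] [Module ℝ Z]
    (C : Set Z) (K : Set X) (h : X → Z) : Prop :=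
  ∀ x ∈ K, ∀ y ∈ K, ∀ t ∈ Icc (0 : ℝ) 1,
    t • h x + (1 - t) • h y - h (t • x + (1 - t) • y) ∈ C

/-- For every `x ∈ K` and every net `(x_α)` in `K` converging to `x` there is a net `(z_α)` in `Z`
(with the same index set) converging to some `z` such that `h(x_α) - z_α ∈ -C` for all `α` and
`h(x) - z ∈ C`.
Nets are indexed by nonempty directed preorders whose underlying type lives in the universe of `X`
(as an assumption, this asks no more than the same condition for nets of every universe). -/
def NetCondition {X : Type u} {Z : Type v} [TopologicalSpace X] [TopologicalSpace Z]
    [AddCommGroup Z] (C : Set Z) (K : Set X) (h : X → Z) : Prop :=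
  ∀ x ∈ K, ∀ (ι : Type u) [Preorder ι] [IsDirectedOrder ι] [Nonempty ι] (xs : ι → X),
    (∀ i, xs i ∈ K) → Tendsto xs atTop (𝓝 x) →
      ∃ (zs : ι → Z) (z : Z), Tendsto zs atTop (𝓝 z) ∧
        (∀ i, h (xs i) - zs i ∈ -C) ∧ h x - z ∈ C

/-! Fan's KKM principle applies to the sets `G y` of those `x ∈ K` where `f x y + g x y` avoids
`-int C`. The net condition makes them closed, coercivity makes `G y₀` compact, and a point of their
intersection is a solution. If the KKM covering property failed at a convex combination `x`,
Jensen's inequality and `int C + C ⊆ int C` would put `g x x` in `-int C`.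

KKM rests on Brouwer's theorem, which is proved by volume: for a smooth retraction `r` of a ball
onto its sphere, `∫ det (1 + t (r' - 1))` is polynomial in `t` and equals the ball's volume for
small `t`, yet vanishes at `t = 1`. -/

/-! ### Brouwer's theorem by a volume argument -/

/-- `det (1 + t A)` has degree at most `dim E` in `t`, so Lagrange interpolation at small nodes
recovers its value at `1`, with weights independent of `A`. -/
theorem exists_det_segment_eq_sum_det {E : Type*} [NormedAddCommGroup E] [NormedSpace ℝ E]
    [FiniteDimensional ℝ E] {δ : ℝ} (hδ : 0 < δ) :
    ∃ (s : Finset ℕ) (τ c : ℕ → ℝ), (∀ j ∈ s, τ j ∈ Ioo 0 δ) ∧ ∑ j ∈ s, c j = 1 ∧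
      ∀ A : E →L[ℝ] E, (1 + A).det = ∑ j ∈ s, c j * (1 + τ j • A).det := by
  classical
  let n := Module.finrank ℝ E
  let s := Finset.range (n + 1)
  let τ : ℕ → ℝ := fun j => δ / (j + 2)
  have hinj : InjOn τ s := by
    intro i _ j _ h
    have : (δ / ((i : ℝ) + 2)) = δ / (j + 2) := h
    have hi : (0 : ℝ) < i + 2 := by positivity
    have hj : (0 : ℝ) < j + 2 := by positivity
    rw [div_eq_div_iff hi.ne' hj.ne'] at this
    have := mul_left_cancel₀ hδ.ne' this
    exact_mod_cast (by linarith : (i : ℝ) = j)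
  refine ⟨s, τ, fun j => (Lagrange.basis s τ j).eval 1, ?_, ?_, ?_⟩
  · intro j _
    have hj : (0 : ℝ) < j + 2 := by positivity
    refine ⟨by positivity, ?_⟩
    rw [div_lt_iff₀ hj]
    nlinarith [(Nat.cast_nonneg j : (0 : ℝ) ≤ j)]
  · rw [← Polynomial.eval_finsetSum, Lagrange.sum_basis hinj ⟨0, by simp [s]⟩]
    simp
  · intro A
    let b := Module.finBasis ℝ E
    let M := LinearMap.toMatrix b b (A : E →ₗ[ℝ] E)
    let p : Polynomial ℝ := Matrix.det
      ((Polynomial.X : Polynomial ℝ) • M.map Polynomial.C +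
        (1 : Matrix (Fin n) (Fin n) ℝ).map Polynomial.C)
    have hp : ∀ t : ℝ, p.eval t = (1 + t • A).det := by
      intro t
      have h1 : (1 + t • A).det = Matrix.det (1 + t • M) := by
        rw [ContinuousLinearMap.det, ← LinearMap.det_toMatrix b]
        congr 1
        simp [M, LinearMap.toMatrix_one]
      rw [h1, ← Polynomial.coe_evalRingHom, RingHom.map_det]
      congr 1
      ext i j
      by_cases hij : i = j <;> simp [hij, add_comm] <;> exact mul_comm _ _
    have hdeg : p.degree < s.card := by
      refine (Polynomial.degree_le_natDegree).trans_lt ?_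
      have : p.natDegree ≤ Fintype.card (Fin n) := Polynomial.natDegree_det_X_add_C_le _ _
      simp only [Fintype.card_fin] at this
      simp only [s, Finset.card_range]
      exact_mod_cast Nat.lt_succ_of_le this
    have h := congrArg (Polynomial.eval 1) (Lagrange.eq_interpolate hinj hdeg)
    rw [Lagrange.interpolate_apply, Polynomial.eval_finsetSum, hp, one_smul] at h
    rw [h]
    refine Finset.sum_congr rfl fun j _ => ?_
    rw [Polynomial.eval_mul, Polynomial.eval_C, hp, mul_comm]

theorem det_one_add_pos {E : Type*} [NormedAddCommGroup E] [NormedSpace ℝ E]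
    [FiniteDimensional ℝ E] {A : E →L[ℝ] E} (hA : ‖A‖ < 1) : 0 < (1 + A).det := by
  have : CompleteSpace E := FiniteDimensional.complete ℝ E
  by_contra! hneg
  have hcont : Continuous fun s : ℝ => (1 + s • A).det :=
    ContinuousLinearMap.continuous_det.comp (by fun_prop)
  obtain ⟨s, hs, h0⟩ : (0 : ℝ) ∈ (fun s : ℝ => (1 + s • A).det) '' Icc 0 1 := by
    refine intermediate_value_Icc' zero_le_one hcont.continuousOn ⟨by simpa using hneg, ?_⟩
    simp [ContinuousLinearMap.det]
  have hlt : ‖-(s • A)‖ < 1 := by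
    rw [norm_neg, norm_smul, Real.norm_of_nonneg hs.1]
    nlinarith [hs.2, norm_nonneg A, hs.1]
  have hu : IsUnit (1 + s • A) := by simpa using isUnit_one_sub_of_norm_lt_one hlt
  have : IsUnit (1 + s • A).det := by
    have h2 := (hu.map (ContinuousLinearMap.toLinearMapRingHom (R₁ := ℝ) (M₁ := E)))
    exact h2.map LinearMap.det
  exact this.ne_zero h0

/-- An outside point is replaced by its radial projection to the sphere, where `k` also vanishes;
this at most doubles the distance to an inside point. -/
theorem lipschitzWith_of_lipschitzOnWith_closedBall {E F : Type*} [NormedAddCommGroup E]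
    [NormedSpace ℝ E] [NormedAddCommGroup F] {k : E → F} {R : ℝ} {L : NNReal} (hR : 0 < R)
    (hL : LipschitzOnWith L k (Metric.closedBall 0 R)) (hk : ∀ x, R ≤ ‖x‖ → k x = 0) :
    LipschitzWith (2 * L) k := by
  have key : ∀ x y : E, ‖x‖ ≤ R → R ≤ ‖y‖ → ‖k x‖ ≤ 2 * L * ‖x - y‖ := by
    intro x y hx hy
    have hy0 : 0 < ‖y‖ := hR.trans_le hy
    set z := (R / ‖y‖) • y
    have hz : ‖z‖ = R := by
      rw [norm_smul, Real.norm_of_nonneg (by positivity)]; field_simp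
    have hyz : ‖y - z‖ = ‖y‖ - R := by
      have : y - z = (1 - R / ‖y‖) • y := by simp [z, sub_smul]
      rw [this, norm_smul, Real.norm_of_nonneg]
      · field_simp
      · rw [sub_nonneg, div_le_one hy0]; exact hy
    have h1 := hL.norm_sub_le (x := x) (y := z) (by simpa using hx) (by simp [hz])
    rw [hk z hz.ge, sub_zero] at h1
    have h2 : ‖x - z‖ ≤ 2 * ‖x - y‖ := by
      have := norm_sub_le_norm_sub_add_norm_sub x y z
      have h3 := norm_sub_norm_le y x
      rw [norm_sub_rev] at h3
      linarith
    nlinarith [L.coe_nonneg]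
  refine LipschitzWith.of_dist_le_mul fun x y => ?_
  rw [dist_eq_norm, dist_eq_norm]
  push_cast
  rcases le_total ‖x‖ R with hx | hx <;> rcases le_total ‖y‖ R with hy | hy
  · have h1 := hL.norm_sub_le (x := x) (y := y) (by simpa using hx) (by simpa using hy)
    nlinarith [L.coe_nonneg, norm_nonneg (x - y), mul_nonneg L.coe_nonneg (norm_nonneg (x - y))]
  · rw [hk y hy, sub_zero]; exact key x y hx hy
  · rw [hk x hx, zero_sub, norm_neg, norm_sub_rev x y]; exact key y x hy hx
  · rw [hk x hx, hk y hy]; simp; positivity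

/-- A small Lipschitz perturbation of the identity, supported in a ball, preserves the volume of
that ball. -/
theorem setIntegral_ball_det_one_add_smul {E : Type*} [NormedAddCommGroup E] [NormedSpace ℝ E]
    [FiniteDimensional ℝ E] [MeasurableSpace E] [BorelSpace E] (μ : MeasureTheory.Measure E)
    [μ.IsAddHaarMeasure] {k : E → E} {k' : E → E →L[ℝ] E} {R : ℝ} {L : NNReal}
    (hL : LipschitzWith L k) (hk : ∀ x, R ≤ ‖x‖ → k x = 0)
    (hk' : ∀ x ∈ Metric.ball (0 : E) R, HasFDerivAt k (k' x) x) {t : ℝ} (ht0 : 0 ≤ t)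
    (ht : t * L < 1) :
    ∫ x in Metric.ball (0 : E) R, (1 + t • k' x).det ∂μ = μ.real (Metric.ball (0 : E) R) := by
  have : CompleteSpace E := FiniteDimensional.complete ℝ E
  set f : E → E := fun x => x + t • k x with hf
  have hinj : Function.Injective f := by
    intro x y hxy
    have h1 : x - y = t • (k y - k x) := by
      have : x + t • k x = y + t • k y := hxy
      rw [smul_sub, sub_eq_sub_iff_add_eq_add, this, add_comm]
    have h2 : ‖x - y‖ ≤ t * L * ‖x - y‖ := by
      conv_lhs => rw [h1, norm_smul, Real.norm_of_nonneg ht0, norm_sub_rev]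
      rw [mul_assoc]
      exact mul_le_mul_of_nonneg_left (hL.norm_sub_le x y) ht0
    have h3 : ‖x - y‖ = 0 := by nlinarith [norm_nonneg (x - y)]
    exact sub_eq_zero.1 (norm_eq_zero.1 h3)
  have hsurj : Function.Surjective f := by
    intro y
    -- Solving `f x = y` amounts to finding a fixed point of this contraction.
    have hc : ContractingWith ⟨t * L, by positivity⟩ (fun x => y - t • k x) := by
      refine ⟨by exact_mod_cast ht, LipschitzWith.of_dist_le_mul fun a b => ?_⟩
      rw [dist_eq_norm, dist_eq_norm, sub_sub_sub_cancel_left, ← smul_sub, norm_smul,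
        Real.norm_of_nonneg ht0, norm_sub_rev]
      change _ ≤ t * L * _
      rw [mul_assoc]
      exact mul_le_mul_of_nonneg_left (hL.norm_sub_le a b) ht0
    have hfix := hc.fixedPoint_isFixedPt
    refine ⟨ContractingWith.fixedPoint _ hc, ?_⟩
    have := hfix.eq
    simp only [hf]
    exact (sub_eq_iff_eq_add.1 this).symm
  have hout : ∀ x, R ≤ ‖x‖ → f x = x := fun x hx => by simp [hf, hk x hx]
  have himage : f '' Metric.ball 0 R = Metric.ball 0 R := by
    ext y
    simp only [mem_image, mem_ball_zero_iff]
    constructor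
    · rintro ⟨x, hx, rfl⟩
      by_contra! h
      have := hinj (hout _ h)
      rw [this] at h
      exact absurd hx (not_lt.2 h)
    · intro hy
      obtain ⟨x, rfl⟩ := hsurj y
      refine ⟨x, ?_, rfl⟩
      by_contra! h
      rw [hout x h] at hy
      exact absurd hy (not_lt.2 h)
  have hderiv : ∀ x ∈ Metric.ball (0 : E) R,
      HasFDerivWithinAt f (1 + t • k' x) (Metric.ball 0 R) x := fun x hx =>
    ((hasFDerivAt_id x).add ((hk' x hx).const_smul t)).hasFDerivWithinAt
  have hcv := MeasureTheory.integral_image_eq_integral_abs_det_fderiv_smul μ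
    measurableSet_ball hderiv hinj.injOn (fun _ => (1 : ℝ))
  rw [himage] at hcv
  simp only [smul_eq_mul, mul_one, MeasureTheory.setIntegral_const] at hcv
  rw [hcv]
  refine MeasureTheory.setIntegral_congr_fun measurableSet_ball fun x hx => ?_
  refine (abs_of_pos (det_one_add_pos ?_)).symm
  rw [norm_smul, Real.norm_of_nonneg ht0]
  refine lt_of_le_of_lt (mul_le_mul_of_nonneg_left ?_ ht0) ht
  exact (hk' x hx).le_of_lipschitz hL

theorem exists_fixedPoint_of_contDiff {E : Type*} [NormedAddCommGroup E] [InnerProductSpace ℝ E]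
    [FiniteDimensional ℝ E] {F : E → E} (hF : ContDiff ℝ 1 F) {R : ℝ} (hR : 0 < R)
    (hsupp : ∀ x, R ≤ ‖x‖ → F x = 0) : ∃ x, F x = x := by
  by_contra! hne
  let _ : MeasurableSpace E := borel E
  have : BorelSpace E := ⟨rfl⟩
  set g : E → E := fun x => x - F x
  have hg0 : ∀ x, g x ≠ 0 := fun x h => hne x (sub_eq_zero.1 h).symm
  have hg : ContDiff ℝ 1 g := contDiff_id.sub hF
  -- Without fixed points, the normalized displacement retracts the ball onto its sphere, since `F =
  -- 0` there.
  set r : E → E := fun x => (R * ‖g x‖⁻¹) • g x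
  have hr : ContDiff ℝ 1 r :=
    (contDiff_const.mul ((hg.norm ℝ hg0).inv fun x => norm_ne_zero_iff.2 (hg0 x))).smul hg
  have hrnorm : ∀ x, ‖r x‖ = R := fun x => by
    have := norm_ne_zero_iff.2 (hg0 x)
    simp only [r]
    rw [norm_smul, Real.norm_of_nonneg (by positivity)]
    field_simp
  have hrid : ∀ x, ‖x‖ = R → r x = x := fun x hx => by
    simp [r, g, hsupp x hx.ge, hx, hR.ne']
  -- As `‖r‖` is constant, the range of the derivative is orthogonal to `r x ≠ 0`.
  have hdr : ∀ x, (fderiv ℝ r x).det = 0 := by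
    intro x
    have hd : HasFDerivAt r (fderiv ℝ r x) x := (hr.differentiable one_ne_zero x).hasFDerivAt
    have h1 := hd.inner ℝ hd
    have h2 : (fun x => inner ℝ (r x) (r x)) = fun _ : E => R ^ 2 := by
      ext x; rw [real_inner_self_eq_norm_sq, hrnorm]
    rw [h2] at h1
    have h3 := h1.unique (hasFDerivAt_const _ _)
    have h4 : ∀ v, inner ℝ (r x) (fderiv ℝ r x v) = 0 := fun v => by
      have := congrArg (fun T : E →L[ℝ] ℝ => T v) h3
      simp [fderivInnerCLM_apply, real_inner_comm] at this
      rw [real_inner_comm] at this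
      linarith [real_inner_comm (r x) (fderiv ℝ r x v)]
    by_contra hdet
    have hu : IsUnit (LinearMap.det (fderiv ℝ r x : E →ₗ[ℝ] E)) := isUnit_iff_ne_zero.2 hdet
    obtain ⟨v, hv⟩ := (LinearMap.equivOfIsUnitDet hu).surjective (r x)
    have hv' : fderiv ℝ r x v = r x := by simpa using hv
    have := h4 v
    rw [hv', real_inner_self_eq_norm_sq, hrnorm] at this
    exact (pow_pos hR 2).ne' this
  classical
  set k : E → E := fun x => if ‖x‖ < R then r x - x else 0
  have hkout : ∀ x, R ≤ ‖x‖ → k x = 0 := fun x hx => if_neg (not_lt.2 hx)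
  have hkin : EqOn k (fun x => r x - x) (Metric.closedBall 0 R) := fun x hx => by
    rcases (mem_closedBall_zero_iff.1 hx).lt_or_eq with h | h
    · exact if_pos h
    · rw [hkout x h.ge]; simp [hrid x h]
  obtain ⟨L, hL⟩ : ∃ L, LipschitzOnWith L (fun x => r x - x) (Metric.closedBall (0 : E) R) :=
    (hr.sub contDiff_id).contDiffOn.exists_lipschitzOnWith one_ne_zero
      (convex_closedBall _ _) (isCompact_closedBall _ _)
  have hkL : LipschitzWith (2 * L) k :=
    lipschitzWith_of_lipschitzOnWith_closedBall hR (fun x hx y hy => by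
      rw [hkin hx, hkin hy]; exact hL hx hy) hkout
  have hk' : ∀ x ∈ Metric.ball (0 : E) R, HasFDerivAt k (fderiv ℝ r x - 1) x := fun x hx =>
    ((hr.differentiable one_ne_zero x).hasFDerivAt.sub (hasFDerivAt_id x)).congr_of_eventuallyEq
      ((hkin.mono Metric.ball_subset_closedBall).eventuallyEq_of_mem
        (Metric.isOpen_ball.mem_nhds hx))
  set δ : ℝ := ((2 * L : NNReal) + 1 : ℝ)⁻¹
  have hδ : 0 < δ := by positivity
  obtain ⟨s, τ, c, hτ, hc, hdet⟩ := exists_det_segment_eq_sum_det (E := E) hδ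
  have hint : ∀ t : ℝ, MeasureTheory.IntegrableOn
      (fun x => (1 + t • (fderiv ℝ r x - 1)).det) (Metric.ball 0 R) := fun t => by
    refine (ContinuousOn.integrableOn_compact (isCompact_closedBall 0 R)
      (Continuous.continuousOn ?_)).mono_set Metric.ball_subset_closedBall
    have := hr.continuous_fderiv one_ne_zero
    exact ContinuousLinearMap.continuous_det.comp (by fun_prop)
  have hvol : ∀ j ∈ s, ∫ x in Metric.ball (0 : E) R, (1 + τ j • (fderiv ℝ r x - 1)).det =
      MeasureTheory.volume.real (Metric.ball (0 : E) R) := fun j hj => by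
    refine setIntegral_ball_det_one_add_smul _ hkL hkout hk' (hτ j hj).1.le ?_
    have h1 := (hτ j hj).2
    have h2 : δ * ((2 * L : NNReal) + 1) = 1 := inv_mul_cancel₀ (by positivity)
    nlinarith [(2 * L).coe_nonneg, (hτ j hj).1]
  have hzero : ∫ x in Metric.ball (0 : E) R, (1 + (fderiv ℝ r x - 1)).det = 0 := by
    refine MeasureTheory.setIntegral_eq_zero_of_forall_eq_zero fun x _ => ?_
    rw [add_sub_cancel]
    exact hdr x
  rw [funext fun x => hdet (fderiv ℝ r x - 1),
    MeasureTheory.integral_finsetSum _ fun j _ => (hint (τ j)).const_mul _] at hzero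
  simp_rw [MeasureTheory.integral_const_mul] at hzero
  rw [Finset.sum_congr rfl fun j hj => by rw [hvol j hj], ← Finset.sum_mul, hc, one_mul] at hzero
  have hpos : 0 < MeasureTheory.volume.real (Metric.ball (0 : E) R) :=
    ENNReal.toReal_pos (Metric.measure_ball_pos _ _ hR).ne' MeasureTheory.measure_ball_lt_top.ne
  exact hpos.ne' hzero

/-- A `C¹` approximation closer than the minimal displacement, with no larger support, would have no
fixed point in the ball. -/
theorem exists_fixedPoint_of_continuous_of_compact_support {E : Type*} [NormedAddCommGroup E]
    [InnerProductSpace ℝ E] [FiniteDimensional ℝ E] {F : E → E} (hF : Continuous F) {R : ℝ}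
    (hR : 0 < R) (hsupp : ∀ x, R ≤ ‖x‖ → F x = 0) : ∃ x, F x = x := by
  obtain ⟨x, -, hx⟩ := (isCompact_closedBall (0 : E) R).exists_isMinOn
    ⟨0, by simp [hR.le]⟩ (f := fun x => dist (F x) x) (by fun_prop)
  refine ⟨x, dist_le_zero.1 ?_⟩
  by_contra! hpos
  obtain ⟨G, hG, hGF, hGs⟩ := hF.exists_contDiff_approx (ε := fun _ => dist (F x) x) 1
    continuous_const fun _ => hpos
  have hG0 : ∀ y, R ≤ ‖y‖ → G y = 0 := fun y hy => by
    by_contra h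
    exact hGs h (hsupp y hy)
  obtain ⟨y, hy⟩ := exists_fixedPoint_of_contDiff hG hR hG0
  have hyR : y ∈ Metric.closedBall (0 : E) R := by
    rw [mem_closedBall_zero_iff]
    by_contra! h
    have h0 := hG0 y h.le
    rw [← hy, h0, norm_zero] at h
    exact absurd h hR.not_gt
  have h1 : dist (F x) x ≤ dist (F y) y := hx hyR
  have h2 := hGF y
  rw [hy, dist_comm] at h2
  exact absurd h2 h1.not_gt

/-- **Brouwer's fixed point theorem** for bounded continuous self-maps of a Euclidean space. -/
theorem exists_fixedPoint_of_continuous_of_bounded {E : Type*} [NormedAddCommGroup E]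
    [InnerProductSpace ℝ E] [FiniteDimensional ℝ E] {F : E → E} (hF : Continuous F) {R : ℝ}
    (hb : ∀ x, ‖F x‖ ≤ R) : ∃ x, F x = x := by
  have hR : 0 ≤ R := (norm_nonneg _).trans (hb 0)
  -- This cutoff is `1` on the `R`-ball, where any fixed point of `χ • F` must lie.
  let χ : E → ℝ := fun x => max 0 (min 1 (R + 1 - ‖x‖))
  have hχ0 : ∀ x, 0 ≤ χ x := fun x => le_max_left _ _
  have hχ1 : ∀ x, χ x ≤ 1 := fun x => max_le zero_le_one (min_le_left _ _)
  obtain ⟨x, hx⟩ := exists_fixedPoint_of_continuous_of_compact_support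
    (F := fun x => χ x • F x) (R := R + 1) (by fun_prop) (by linarith) fun x hx => by
      have : χ x = 0 := max_eq_left ((min_le_right _ _).trans (by linarith))
      simp [this]
  refine ⟨x, ?_⟩
  have hxR : ‖x‖ ≤ R := by
    rw [← hx, norm_smul, Real.norm_of_nonneg (hχ0 x)]
    exact (mul_le_of_le_one_left (norm_nonneg _) (hχ1 x)).trans (hb x)
  have : χ x = 1 := by
    simp only [χ]
    rw [min_eq_left (by linarith), max_eq_right zero_le_one]
  simpa [this] using hx

/-! ### The KKM principle -/

/-- A finite form of the Knaster–Kuratowski–Mazurkiewicz lemma: if every convex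
combination `∑ i, t i • y i` lies in some `G i` with `0 < t i`, then the closed sets `G i` have a
common point in the convex set. -/
theorem exists_mem_forall_of_fintype_of_knasterKuratowskiMazurkiewicz {X ι : Type*}
    [AddCommGroup X] [Module ℝ X] [TopologicalSpace X] [IsTopologicalAddGroup X]
    [ContinuousSMul ℝ X] [Fintype ι] [Nonempty ι] {K : Set X} (hK : Convex ℝ K) (y : ι → X)
    (hy : ∀ i, y i ∈ K) (G : ι → Set X) (hG : ∀ i, IsClosed (G i))
    (hkkm : ∀ t : ι → ℝ, (∀ i, 0 ≤ t i) → ∑ i, t i = 1 →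
      ∃ i, 0 < t i ∧ ∑ j, t j • y j ∈ G i) :
    ∃ x ∈ K, ∀ i, x ∈ G i := by
  by_contra! hne
  let s : EuclideanSpace ℝ ι → ℝ := fun w => ∑ i, max (w i) 0
  -- These weights extend barycentric coordinates to the whole space: their sum is at least `1`, and
  -- `a w = w` on the simplex.
  let a : EuclideanSpace ℝ ι → ι → ℝ := fun w i => max (w i) 0 + max (1 - s w) 0 / Fintype.card ι
  have hcard : (0 : ℝ) < Fintype.card ι := by exact_mod_cast Fintype.card_pos
  have ha0 : ∀ w i, 0 ≤ a w i := fun w i => by positivity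
  have hs : Continuous s := by fun_prop
  have hac : ∀ i, Continuous fun w => a w i := fun i => by fun_prop
  have hasum : ∀ w, 1 ≤ ∑ i, a w i := fun w => by
    have : ∑ i, a w i = s w + max (1 - s w) 0 := by
      simp only [a, Finset.sum_add_distrib, Finset.sum_const, Finset.card_univ, nsmul_eq_mul]
      rw [mul_div_cancel₀ _ hcard.ne']
    rw [this]
    linarith [le_max_left (1 - s w) 0]
  let p : EuclideanSpace ℝ ι → X := fun w => (∑ i, a w i)⁻¹ • ∑ i, a w i • y i
  have hpK : ∀ w, p w ∈ K := fun w =>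
    hK.centerMass_mem (fun i _ => ha0 w i) (zero_lt_one.trans_le (hasum w)) fun i _ => hy i
  have hpc : Continuous p := by
    refine Continuous.smul (Continuous.inv₀ (continuous_finsetSum _ fun i _ => hac i) fun w => ?_)
      (continuous_finsetSum _ fun i _ => (hac i).smul continuous_const)
    exact (zero_lt_one.trans_le (hasum w)).ne'
  obtain ⟨φ, hφ⟩ := PartitionOfUnity.exists_isSubordinate (isClosed_univ (X := EuclideanSpace ℝ ι))
    (fun i => p ⁻¹' (G i)ᶜ) (fun i => (hG i).isOpen_compl.preimage hpc) fun w _ => by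
      obtain ⟨i, hi⟩ := hne (p w) (hpK w)
      exact mem_iUnion.2 ⟨i, hi⟩
  have hφsum : ∀ w, ∑ i, φ i w = 1 := fun w => by
    rw [← finsum_eq_sum_of_fintype]; exact φ.sum_eq_one (mem_univ w)
  let F : EuclideanSpace ℝ ι → EuclideanSpace ℝ ι := fun w => WithLp.toLp 2 fun i => φ i w
  have hF : Continuous F :=
    (PiLp.continuous_toLp 2 _).comp (continuous_pi fun i => (φ i).continuous)
  obtain ⟨w, hw⟩ := exists_fixedPoint_of_continuous_of_bounded hF
    (R := √(Fintype.card ι)) fun w => by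
      rw [EuclideanSpace.norm_eq]
      refine Real.sqrt_le_sqrt ?_
      have : ∀ i ∈ Finset.univ, ‖F w i‖ ^ 2 ≤ (1 : ℝ) := fun i _ => by
        have h0 : 0 ≤ F w i := φ.nonneg i w
        have h1 : F w i ≤ 1 := φ.le_one i w
        rw [Real.norm_of_nonneg h0]
        exact pow_le_one₀ h0 h1
      simpa using Finset.sum_le_sum this
  have hwφ : ∀ i, w i = φ i w := fun i => by conv_lhs => rw [← hw]
  have hw0 : ∀ i, 0 ≤ w i := fun i => hwφ i ▸ φ.nonneg i w
  have hw1 : ∑ i, w i = 1 := by simp_rw [hwφ]; exact hφsum w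
  have hsw : s w = 1 := by simp only [s, max_eq_left (hw0 _), hw1]
  have haw : ∀ i, a w i = w i := fun i => by simp [a, hsw, hw0 i]
  have hpw : p w = ∑ i, w i • y i := by simp [p, haw, hw1]
  obtain ⟨i, hi, hiG⟩ := hkkm w hw0 hw1
  rw [← hpw] at hiG
  -- At the fixed point `w i = φ i w > 0`, so subordination forces `p w ∉ G i`.
  refine hφ i (subset_tsupport _ ?_) hiG
  rw [Function.mem_support, ← hwφ]
  exact hi.ne'

/-- **Fan's lemma** (the KKM principle). -/
theorem exists_mem_forall_of_knasterKuratowskiMazurkiewicz {X : Type*}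
    [AddCommGroup X] [Module ℝ X] [TopologicalSpace X] [IsTopologicalAddGroup X]
    [ContinuousSMul ℝ X] {K : Set X} (hK : Convex ℝ K) (G : X → Set X)
    (hGK : ∀ y ∈ K, G y ⊆ K) (hG : ∀ y ∈ K, IsClosed (G y))
    {y₀ : X} (hy₀ : y₀ ∈ K) (hcomp : IsCompact (G y₀))
    (hkkm : ∀ (s : Finset X) (t : X → ℝ), (∀ y ∈ s, y ∈ K) → (∀ y ∈ s, 0 ≤ t y) →
      ∑ y ∈ s, t y = 1 → ∃ y ∈ s, 0 < t y ∧ ∑ z ∈ s, t z • z ∈ G y) :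
    ∃ x ∈ K, ∀ y ∈ K, x ∈ G y := by
  classical
  have hne : (G y₀ ∩ ⋂ y : K, G y).Nonempty := by
    refine hcomp.inter_iInter_nonempty _ (fun y => hG y y.2) fun u => ?_
    let s : Finset X := insert y₀ (u.image (↑))
    have hs : ∀ y ∈ s, y ∈ K := by
      intro y hy
      rcases Finset.mem_insert.1 hy with rfl | h
      · exact hy₀
      · obtain ⟨z, -, rfl⟩ := Finset.mem_image.1 h
        exact z.2
    have : Nonempty s := ⟨⟨y₀, Finset.mem_insert_self _ _⟩⟩
    obtain ⟨x, -, hx⟩ := exists_mem_forall_of_fintype_of_knasterKuratowskiMazurkiewicz hK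
      (fun y : s => (y : X)) (fun y => hs y y.2) (fun y : s => G y) (fun y => hG y (hs y y.2))
      fun t ht0 ht1 => by
        let t' : X → ℝ := fun y => if h : y ∈ s then t ⟨y, h⟩ else 0
        have ht' : ∀ y : s, t' y = t y := fun y => dif_pos y.2
        obtain ⟨y, hy, hpos, hmem⟩ := hkkm s t' hs (fun y hy => ht' ⟨y, hy⟩ ▸ ht0 _)
          (by rw [← Finset.sum_coe_sort, ← ht1]; exact Finset.sum_congr rfl fun y _ => ht' y)
        refine ⟨⟨y, hy⟩, ht' ⟨y, hy⟩ ▸ hpos, ?_⟩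
        rw [← Finset.sum_coe_sort] at hmem
        simpa only [ht'] using hmem
    refine ⟨x, hx ⟨y₀, Finset.mem_insert_self _ _⟩, mem_iInter₂.2 fun y hy => ?_⟩
    exact hx ⟨y, Finset.mem_insert_of_mem (Finset.mem_image_of_mem _ hy)⟩
  obtain ⟨x, hx₀, hx⟩ := hne
  exact ⟨x, hGK y₀ hy₀ hx₀, fun y hy => mem_iInter.1 hx ⟨y, hy⟩⟩

/-! ### Cone interiors, Jensen's inequality and closedness -/

theorem PointedCone.add_mem_interior {Z : Type*} [AddCommGroup Z] [Module ℝ Z]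
    [TopologicalSpace Z] [IsTopologicalAddGroup Z] (C : PointedCone ℝ Z) {a b : Z}
    (ha : a ∈ interior (C : Set Z)) (hb : b ∈ C) : a + b ∈ interior (C : Set Z) := by
  refine interior_maximal (t := interior (C : Set Z) + {b}) ?_ isOpen_interior.add_right
    (add_mem_add ha rfl)
  rintro _ ⟨c, hc, _, rfl, rfl⟩
  exact C.add_mem (interior_subset hc) hb

theorem PointedCone.smul_mem_interior {Z : Type*} [AddCommGroup Z] [Module ℝ Z]
    [TopologicalSpace Z] [ContinuousSMul ℝ Z] (C : PointedCone ℝ Z) {t : ℝ} (ht : 0 < t) {a : Z}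
    (ha : a ∈ interior (C : Set Z)) : t • a ∈ interior (C : Set Z) := by
  refine interior_maximal (t := t • interior (C : Set Z)) ?_ (isOpen_interior.smul₀ ht.ne')
    (smul_mem_smul_set ha)
  rintro _ ⟨c, hc, rfl⟩
  exact C.smul_mem ht.le (interior_subset hc)

theorem PointedCone.convexCombination_mem_interior {Z ι : Type*} [AddCommGroup Z] [Module ℝ Z]
    [TopologicalSpace Z] [IsTopologicalAddGroup Z] [ContinuousSMul ℝ Z] (C : PointedCone ℝ Z)
    {s : Finset ι} {t : ι → ℝ} {z : ι → Z} (ht : ∀ i ∈ s, 0 ≤ t i) (hsum : 0 < ∑ i ∈ s, t i)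
    (hz : ∀ i ∈ s, 0 < t i → z i ∈ interior (C : Set Z)) :
    ∑ i ∈ s, t i • z i ∈ interior (C : Set Z) := by
  classical
  obtain ⟨i, hi, hti⟩ := Finset.exists_lt_of_sum_lt (s := s) (f := fun _ => (0 : ℝ)) (g := t)
    (by simpa using hsum)
  rw [← Finset.add_sum_erase s _ hi]
  refine C.add_mem_interior (C.smul_mem_interior hti (hz i hi hti)) (C.sum_mem fun j hj => ?_)
  have hj := Finset.mem_of_mem_erase hj
  rcases (ht j hj).eq_or_lt with h | h
  · simp [← h]
  · exact C.smul_mem h.le (interior_subset (hz j hj h))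

/-- Jensen's inequality for cone-convex maps. -/
theorem CConvexOn.sum_smul_sub_mem {X : Type u} {Z : Type v} [AddCommGroup X] [Module ℝ X]
    [AddCommGroup Z] [Module ℝ Z] {C : PointedCone ℝ Z} {K : Set X} (hK : Convex ℝ K) {h : X → Z}
    (hh : CConvexOn (C : Set Z) K h) {ι : Type*} (s : Finset ι) (t : ι → ℝ) (y : ι → X)
    (hy : ∀ i ∈ s, y i ∈ K) (ht : ∀ i ∈ s, 0 ≤ t i) (hsum : ∑ i ∈ s, t i = 1) :
    ∑ i ∈ s, t i • h (y i) - h (∑ i ∈ s, t i • y i) ∈ C := by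
  -- The `C`-epigraph of `h` is convex.
  let S : Set (X × Z) := {q | q.1 ∈ K ∧ q.2 - h q.1 ∈ C}
  have hS : Convex ℝ S := by
    rintro ⟨x, a⟩ ⟨hx, ha⟩ ⟨x', a'⟩ ⟨hx', ha'⟩ p q hp hq hpq
    refine ⟨hK hx hx' hp hq hpq, ?_⟩
    obtain rfl : q = 1 - p := by linarith
    have h1 := hh x hx x' hx' p ⟨hp, by linarith⟩
    have h2 := C.add_mem (C.add_mem (C.smul_mem hp ha) (C.smul_mem hq ha')) h1
    convert h2 using 1
    simp only [Prod.fst_add, Prod.snd_add, Prod.smul_fst, Prod.smul_snd, smul_sub]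
    abel
  have := (hS.sum_mem (z := fun i => (y i, h (y i))) ht hsum fun i hi =>
    ⟨hy i hi, by simp⟩).2
  simpa [Prod.fst_sum, Prod.snd_sum] using this

theorem NetCondition.isClosed_setOf_notMem_neg_interior {X : Type u} {Z : Type v}
    [TopologicalSpace X] [AddCommGroup Z] [Module ℝ Z] [TopologicalSpace Z]
    [IsTopologicalAddGroup Z] {C : PointedCone ℝ Z} {K : Set X} (hK : IsClosed K) {h : X → Z}
    (hh : NetCondition (C : Set Z) K h) :
    IsClosed {x | x ∈ K ∧ h x ∉ -interior (C : Set Z)} := by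
  refine isClosed_of_closure_subset fun x hx => ?_
  have hxK : x ∈ K := closure_minimal (fun _ h => h.1) hK hx
  refine ⟨hxK, fun hneg => ?_⟩
  -- Neighbourhoods under reverse inclusion give a net indexed in the universe of `X`.
  let ι := (OrderDual {U : Set X // U ∈ 𝓝 x})
  have : IsDirectedOrder ι := ⟨fun U V =>
    ⟨OrderDual.toDual ⟨U.ofDual.1 ∩ V.ofDual.1, inter_mem U.ofDual.2 V.ofDual.2⟩,
      inter_subset_left, inter_subset_right⟩⟩
  have : Nonempty ι := ⟨OrderDual.toDual ⟨univ, univ_mem⟩⟩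
  have hex : ∀ U : ι, ∃ a ∈ U.ofDual.1, a ∈ K ∧ h a ∉ -interior (C : Set Z) := fun U =>
    mem_closure_iff_nhds.1 hx _ U.ofDual.2
  choose xs hxU hxs using hex
  have hlim : Tendsto xs atTop (𝓝 x) := fun U hU =>
    mem_atTop_sets.2 ⟨OrderDual.toDual ⟨U, hU⟩, fun V hV => hV (hxU V)⟩
  obtain ⟨zs, z, hzlim, hle, hz⟩ := hh x hxK ι xs (fun i => (hxs i).1) hlim
  -- Membership in `-int C` passes from `h x` to `z`, by openness to some `zs i`, and then to `h (xs
  -- i)`.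
  have hzneg : z ∈ -interior (C : Set Z) := by
    have := C.add_mem_interior hneg hz
    rw [Set.mem_neg]
    convert this using 1
    abel
  obtain ⟨i, hi⟩ := (hzlim.eventually (isOpen_interior.neg.mem_nhds hzneg)).exists
  refine (hxs i).2 ?_
  have := C.add_mem_interior hi (hle i)
  rw [Set.mem_neg]
  convert this using 1
  abel

/-! ### The equilibrium theorem -/

theorem theorem5p1 {X : Type u} {Z : Type v}
    [AddCommGroup X] [Module ℝ X] [TopologicalSpace X] [IsTopologicalAddGroup X]
    [ContinuousSMul ℝ X] [T2Space X]
    [AddCommGroup Z] [Module ℝ Z] [TopologicalSpace Z] [IsTopologicalAddGroup Z]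
    [ContinuousSMul ℝ Z] [T2Space Z]
    (C : PointedCone ℝ Z)
    (hC_pointed : (C : Set Z) ∩ -(C : Set Z) = {0})
    (hC_int : (interior (C : Set Z)).Nonempty)
    (K : Set X) (hK_ne : K.Nonempty) (hK_conv : Convex ℝ K) (hK_closed : IsClosed K)
    (f g : X → X → Z)
    (h_net : ∀ y ∈ K, NetCondition (C : Set Z) K (fun x => f x y + g x y))
    (h_conv : ∀ x ∈ K, CConvexOn (C : Set Z) K (f x) ∧ CConvexOn (C : Set Z) K (g x))
    (h_diag : ∀ x ∈ K, f x x = 0 ∧ g x x ∉ -interior (C : Set Z))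
    (h_coer : ∃ K₀ : Set X, K₀.Nonempty ∧ IsCompact K₀ ∧
      ∃ y₀ ∈ K, ∀ x ∈ K \ K₀, f x y₀ + g x y₀ ∈ -interior (C : Set Z)) :
    ∃ x₀ ∈ K, ∀ y ∈ K, f x₀ y + g x₀ y ∉ -interior (C : Set Z) := by
  obtain ⟨K₀, -, hK₀, y₀, hy₀, hcoer⟩ := h_coer
  let G : X → Set X := fun y => {x | x ∈ K ∧ f x y + g x y ∉ -interior (C : Set Z)}
  have hG : ∀ y ∈ K, IsClosed (G y) := fun y hy =>
    (h_net y hy).isClosed_setOf_notMem_neg_interior hK_closed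
  have hG₀ : G y₀ ⊆ K₀ := fun x hx => by
    by_contra hx₀
    exact hx.2 (hcoer x ⟨hx.1, hx₀⟩)
  obtain ⟨x, hxK, hx⟩ := exists_mem_forall_of_knasterKuratowskiMazurkiewicz hK_conv G
    (fun y _ x hx => hx.1) hG hy₀ (hK₀.of_isClosed_subset (hG y₀ hy₀) hG₀)
    fun s t hs ht0 ht1 => by
      by_contra! hne
      set x := ∑ y ∈ s, t y • y
      have hxK : x ∈ K := hK_conv.sum_mem ht0 ht1 hs
      have hint : ∀ y ∈ s, 0 < t y → -(f x y + g x y) ∈ interior (C : Set Z) := fun y hy hty => by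
        by_contra h
        exact hne y hy hty ⟨hxK, h⟩
      have h1 := C.convexCombination_mem_interior ht0 (ht1 ▸ zero_lt_one) hint
      have hf := (h_conv x hxK).1.sum_smul_sub_mem hK_conv s t id hs ht0 ht1
      have hg := (h_conv x hxK).2.sum_smul_sub_mem hK_conv s t id hs ht0 ht1
      have hxx : ∑ y ∈ s, t y • id y = x := rfl
      rw [hxx, (h_diag x hxK).1] at hf
      rw [hxx] at hg
      -- The weighted sums cancel, leaving `-g x x ∈ int C`.
      have h2 := C.add_mem_interior h1 (C.add_mem hf hg)
      refine (h_diag x hxK).2 ?_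
      rw [Set.mem_neg]
      convert h2 using 1
      simp only [id, smul_neg, smul_add, Finset.sum_neg_distrib, Finset.sum_add_distrib]
      abel
  exact ⟨x, hxK, fun y hy => (hx y hy).2⟩
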